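/- For a finite simple graph $G$ of order $n$ with adjacency matrix $A$, and a real number $p\ge 1$, let $\|G\|_{S_p}=\bigl(\sigma_1(A)^p+\cdots+\sigma_n(A)^p\bigr)^{1/p}$ be the Schatten $p$-norm of $A$, where $\sigma_1(A)\ge\cdots\ge\sigma_n(A)$ are the singular values of $A$. (a) If $1\le p<2$ and $G$ is a graph of order $n$, then $$\|G\|_{S_p}^p\le 2^{-p}n^{1+p/2}+n^p .$$ (b) This bound is asymptotically tight for every order. There is a sequence of graphs $(G_n)$, with $G_n$ of order $n$, such that for every fixed real $p$ with $1\le p<2$ $$\|G_n\|_{S_p}^p=\bigl(2^{-p}+o(1)\bigr)\,n^{1+p/2}\qquad(n\to\infty).$$ Moreover, for every $n\ge 5$ one can take $G_n$ to be the Paley graph of order $q$ together with $n-q$ isolated vertices, where $q$ is the largest prime with $q\le n$ and $q\equiv 1\pmod 4$. (The Paley graph of order $q$ has vertex set $\mathbb{Z}/q\mathbb{Z}$, and two distinct elements are adjacent if and only if their difference is a square.) -/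

import Mathlib

open Filter Topology

noncomputable section

/-- The Schatten `p`-norm `(σ₁(A)^p + ⋯ + σ_m(A)^p)^(1/p)` of a complex matrix `A` with `m` rows.
The singular values are those of the linear map `x ↦ A x` between the Euclidean (`ℓ²`) spaces; the
sequence `LinearMap.singularValues` is indexed from `0`, decreasing, and counts multiplicity. -/
def schattenNorm {m n : Type*} [Fintype m] [Fintype n] [DecidableEq n]
    (p : ℝ) (A : Matrix m n ℂ) : ℝ :=
  (∑ i ∈ Finset.range (Fintype.card m),
    (LinearMap.singularValues (Matrix.toEuclideanLin A) i) ^ p) ^ (1 / p)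

open Classical in
/-- The Schatten `p`-norm of a finite graph is that of its adjacency matrix. -/
def SimpleGraph.schattenNorm {V : Type*} [Fintype V] (p : ℝ) (G : SimpleGraph V) : ℝ :=
  _root_.schattenNorm p (G.adjMatrix ℂ)

/-- The Paley graph on `ZMod q`: distinct `x` and `y` are adjacent when their difference is a
square. It is used only for primes `q ≡ 1 (mod 4)`; then `-1` is a square, so that `x - y` is a
square if and only if `y - x` is one. -/
def paleyGraph (q : ℕ) : SimpleGraph (ZMod q) :=
  SimpleGraph.fromRel fun x y => IsSquare (x - y)

end

open Matrix in
theorem charpoly_toEuclideanLin {V : Type*} [Fintype V] [DecidableEq V] (B : Matrix V V ℂ) :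
    (Matrix.toEuclideanLin B).charpoly = B.charpoly := by
  rw [Matrix.toEuclideanLin_eq_toLin_orthonormal, Matrix.charpoly_toLin]

open Matrix in
/-- A sum over the singular values of `A` is a sum over the roots of the characteristic polynomial
of `Aᴴ A`. -/
theorem sum_singularValues_eq_sum_roots {V : Type*} [Fintype V] [DecidableEq V]
    (A : Matrix V V ℂ) (f : ℝ → ℝ) :
    ∑ i ∈ Finset.range (Fintype.card V), f (LinearMap.singularValues (toEuclideanLin A) i) =
      ((Aᴴ * A).charpoly.roots.map fun z => f √z.re).sum := by
  have hn : Module.finrank ℂ (EuclideanSpace ℂ V) = Fintype.card V := by simp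
  have hT := (toEuclideanLin A).isSymmetric_adjoint_comp_self
  have hc : LinearMap.adjoint (toEuclideanLin A) ∘ₗ toEuclideanLin A =
      toEuclideanLin (Aᴴ * A) := by
    rw [← toEuclideanLin_conjTranspose_eq_adjoint]
    exact (toLpLin_mul 2 2 2 Aᴴ A).symm
  have h : (Aᴴ * A).charpoly =
      ∏ i, (Polynomial.X - Polynomial.C ((hT.eigenvalues hn i : ℝ) : ℂ)) := by
    rw [← charpoly_toEuclideanLin, ← hc]
    exact hT.charpoly_eq hn
  rw [h, Polynomial.roots_prod _ _ (Finset.prod_ne_zero_iff.2 fun i _ =>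
    Polynomial.X_sub_C_ne_zero _)]
  simp only [Polynomial.roots_X_sub_C, Multiset.bind_singleton, Multiset.map_map]
  rw [Finset.sum_range]
  refine Finset.sum_congr rfl fun i _ => ?_
  rw [LinearMap.singularValues_fin _ hn]
  simp

open Matrix in
theorem sum_singularValues_eq_sum_eigenvalues {V : Type*} [Fintype V] [DecidableEq V]
    (A : Matrix V V ℂ) (f : ℝ → ℝ) :
    ∑ i ∈ Finset.range (Fintype.card V), f (LinearMap.singularValues (toEuclideanLin A) i) =
      ∑ j, f √((isHermitian_conjTranspose_mul_self A).eigenvalues j) := by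
  rw [sum_singularValues_eq_sum_roots,
    (isHermitian_conjTranspose_mul_self A).roots_charpoly_eq_eigenvalues, Multiset.map_map]
  simp

theorem schattenNorm_rpow {V : Type*} [Fintype V] [DecidableEq V] (A : Matrix V V ℂ) {p : ℝ}
    (hp : 1 ≤ p) : schattenNorm p A ^ p = ∑ i ∈ Finset.range (Fintype.card V),
      (LinearMap.singularValues (Matrix.toEuclideanLin A) i) ^ p := by
  have h : 0 ≤ ∑ i ∈ Finset.range (Fintype.card V),
      (LinearMap.singularValues (Matrix.toEuclideanLin A) i) ^ p :=
    Finset.sum_nonneg fun i _ => Real.rpow_nonneg (LinearMap.singularValues_nonneg _ i) _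
  rw [schattenNorm, ← Real.rpow_mul h, one_div_mul_cancel (by linarith), Real.rpow_one]

theorem SimpleGraph.schattenNorm_rpow {V : Type*} [Fintype V] [DecidableEq V] (G : SimpleGraph V)
    [DecidableRel G.Adj] {p : ℝ} (hp : 1 ≤ p) :
    G.schattenNorm p ^ p = ∑ i ∈ Finset.range (Fintype.card V),
      (LinearMap.singularValues (Matrix.toEuclideanLin (G.adjMatrix ℂ)) i) ^ p := by
  rw [← _root_.schattenNorm_rpow _ hp, SimpleGraph.schattenNorm]
  congr!

open Matrix in
/-- The largest eigenvalue of a Hermitian matrix is at least every Rayleigh quotient. -/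
theorem Matrix.IsHermitian.exists_rayleigh_le {V : Type*} [Fintype V] [DecidableEq V] [Nonempty V]
    {B : Matrix V V ℂ} (hB : B.IsHermitian) (x : EuclideanSpace ℂ V) :
    ∃ j, (inner ℂ x (toEuclideanLin B x)).re ≤ hB.eigenvalues j * ‖x‖ ^ 2 := by
  obtain ⟨j, hj⟩ := Finite.exists_max hB.eigenvalues
  refine ⟨j, ?_⟩
  have hs : (toEuclideanLin B).IsSymmetric := isSymmetric_toEuclideanLin_iff.2 hB
  have hv (i : V) : toEuclideanLin B (hB.eigenvectorBasis i) =
      (hB.eigenvalues i : ℂ) • hB.eigenvectorBasis i := by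
    have := hB.mulVec_eigenvectorBasis i
    ext k
    simpa using congrFun this k
  rw [← hB.eigenvectorBasis.sum_inner_mul_inner, ← hB.eigenvectorBasis.sum_sq_norm_inner_right x,
    Complex.re_sum, Finset.mul_sum]
  refine Finset.sum_le_sum fun i _ => ?_
  rw [← hs, hv, inner_smul_left, mul_left_comm, Complex.conj_ofReal, Complex.re_ofReal_mul,
    ← inner_conj_symm x]
  have : (starRingEnd ℂ) (inner ℂ (hB.eigenvectorBasis i) x) *
      inner ℂ (hB.eigenvectorBasis i) x = (‖inner ℂ (hB.eigenvectorBasis i) x‖ ^ 2 : ℝ) := by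
    rw [Complex.conj_mul']; norm_cast
  rw [this, Complex.ofReal_re]
  gcongr
  exact hj i

theorem Finset.sum_rpow_le_card_rpow_mul {ι : Type*} (s : Finset ι) (f : ι → ℝ)
    (hf : ∀ i ∈ s, 0 ≤ f i) {r : ℝ} (h0 : 0 < r) (h1 : r ≤ 1) :
    ∑ i ∈ s, f i ^ r ≤ (s.card : ℝ) ^ (1 - r) * (∑ i ∈ s, f i) ^ r := by
  have h := Real.rpow_sum_le_const_mul_sum_rpow s (fun i => f i ^ r) (one_le_inv₀ h0 |>.2 h1)
  have e1 : ∑ i ∈ s, |f i ^ r| = ∑ i ∈ s, f i ^ r :=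
    sum_congr rfl fun i hi => abs_of_nonneg (Real.rpow_nonneg (hf i hi) _)
  have e2 : ∑ i ∈ s, |f i ^ r| ^ r⁻¹ = ∑ i ∈ s, f i :=
    sum_congr rfl fun i hi => by
      rw [abs_of_nonneg (Real.rpow_nonneg (hf i hi) _), Real.rpow_rpow_inv (hf i hi) h0.ne']
  rw [e1, e2] at h
  have hS : 0 ≤ ∑ i ∈ s, f i ^ r := sum_nonneg fun i hi => Real.rpow_nonneg (hf i hi) _
  have h2 := Real.rpow_le_rpow (by positivity) h h0.le
  rw [Real.rpow_inv_rpow hS h0.ne', Real.mul_rpow (by positivity) (sum_nonneg hf),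
    ← Real.rpow_mul (by positivity)] at h2
  convert h2 using 3
  field_simp

open Matrix in
theorem SimpleGraph.schattenNorm_rpow_le {V : Type*} [Fintype V] (G : SimpleGraph V) {p : ℝ}
    (hp : 1 ≤ p) (hp2 : p < 2) :
    G.schattenNorm p ^ p ≤ (2 : ℝ) ^ (-p) * (Fintype.card V : ℝ) ^ (1 + p / 2) +
      (Fintype.card V : ℝ) ^ p := by
  classical
  rw [G.schattenNorm_rpow hp]
  rcases isEmpty_or_nonempty V with hV | hV
  · simp only [Fintype.card_eq_zero, Finset.range_zero, Finset.sum_empty]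
    positivity
  set n : ℝ := (Fintype.card V : ℝ) with hn
  have hn0 : 0 < n := by simp [hn, Fintype.card_pos]
  set A : Matrix V V ℂ := G.adjMatrix ℂ
  have hA : Aᴴ = A := by
    ext i j
    simp [A, SimpleGraph.adjMatrix_apply, conjTranspose_apply, G.adj_comm]
  set hB := isHermitian_conjTranspose_mul_self A
  set β := hB.eigenvalues with hβ
  have hβ0 (j : V) : 0 ≤ β j := eigenvalues_conjTranspose_mul_self_nonneg A j
  set s : ℝ := ∑ v, (G.degree v : ℝ) with hs
  have htr : ∑ j, β j = s := by
    have h1 : (Aᴴ * A).trace = ∑ v, (G.degree v : ℂ) := by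
      simp only [hA, trace, diag_apply, A, SimpleGraph.adjMatrix_mul_self_apply_self]
    have h2 := hB.trace_eq_sum_eigenvalues.symm.trans h1
    rw [hs]
    apply Complex.ofReal_injective
    push_cast
    exact h2
  have hdeg (v : V) : (G.degree v : ℝ) ≤ n := by
    rw [hn]
    exact_mod_cast (G.degree_lt_card_verts v).le
  have hs0 : 0 ≤ s := Finset.sum_nonneg fun _ _ => by positivity
  have hsn : s ≤ n ^ 2 := by
    calc s ≤ ∑ _v : V, n := Finset.sum_le_sum fun v _ => hdeg v
      _ = n ^ 2 := by simp [hn, sq]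
  obtain ⟨j₀, hj₀⟩ : ∃ j, (s / n) ^ 2 ≤ β j := by
    obtain ⟨j, hj⟩ := hB.exists_rayleigh_le (WithLp.toLp 2 fun _ => 1)
    refine ⟨j, ?_⟩
    have h1 : ‖(WithLp.toLp 2 fun _ => 1 : EuclideanSpace ℂ V)‖ ^ 2 = n := by
      simp [EuclideanSpace.norm_sq_eq, hn]
    have h2 : (inner ℂ (WithLp.toLp 2 fun _ => 1 : EuclideanSpace ℂ V)
        (toEuclideanLin (Aᴴ * A) (WithLp.toLp 2 fun _ => 1))).re =
        ∑ v, (G.degree v : ℝ) ^ 2 := by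
      have h3 : toEuclideanLin (Aᴴ * A) = toEuclideanLin Aᴴ ∘ₗ toEuclideanLin A :=
        toLpLin_mul 2 2 2 Aᴴ A
      rw [h3, toEuclideanLin_conjTranspose_eq_adjoint, LinearMap.comp_apply,
        LinearMap.adjoint_inner_right]
      have h4 : toEuclideanLin A (WithLp.toLp 2 fun _ => 1) =
          WithLp.toLp 2 fun v => (G.degree v : ℂ) := by
        ext v
        have := SimpleGraph.adjMatrix_mulVec_const_apply (G := G) (α := ℂ) (a := 1) (v := v)
        rw [mul_one] at this
        exact this
      rw [h4]
      simp only [PiLp.inner_apply, RCLike.inner_apply, Complex.conj_natCast, Complex.re_sum, ← sq]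
      refine Finset.sum_congr rfl fun v _ => ?_
      norm_cast
    rw [h1, h2] at hj
    have hcs := sq_sum_le_card_mul_sum_sq (s := Finset.univ) (f := fun v => (G.degree v : ℝ))
    rw [Finset.card_univ, ← hn, ← hs] at hcs
    rw [div_pow, div_le_iff₀ (by positivity)]
    nlinarith
  have hsum := sum_singularValues_eq_sum_eigenvalues A fun x => x ^ p
  have hsq (j : V) : √(β j) ^ p = β j ^ (p / 2) := by
    rw [Real.sqrt_eq_rpow, ← Real.rpow_mul (hβ0 j)]; ring_nf
  change ∑ i ∈ Finset.range (Fintype.card V), (toEuclideanLin A).singularValues i ^ p =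
    ∑ j, √(β j) ^ p at hsum
  have hgoal : ∑ j, √(β j) ^ p ≤ 2 ^ (-p) * n ^ (1 + p / 2) + n ^ p := by
    simp only [hsq]
    rw [← Finset.sum_erase_add _ _ (Finset.mem_univ j₀)]
    have hle : β j₀ ≤ n ^ 2 :=
      (Finset.single_le_sum (fun j _ => hβ0 j) (Finset.mem_univ j₀)).trans (htr.le.trans hsn)
    have hrest : ∑ j ∈ Finset.univ.erase j₀, β j = s - β j₀ := by
      rw [← htr, ← Finset.sum_erase_add _ _ (Finset.mem_univ j₀)]; ring
    have hr : s - β j₀ ≤ n ^ 2 / 4 := by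
      have : s - (s / n) ^ 2 ≤ n ^ 2 / 4 := by
        have e : n * (s / n) = s := by field_simp
        nlinarith [sq_nonneg (s / n - n / 2)]
      linarith
    have hr0 : 0 ≤ s - β j₀ := hrest ▸ Finset.sum_nonneg fun j _ => hβ0 j
    have h1 := Finset.sum_rpow_le_card_rpow_mul (Finset.univ.erase j₀) β (fun j _ => hβ0 j)
      (by linarith : 0 < p / 2) (by linarith)
    rw [hrest] at h1
    have hcard : ((Finset.univ.erase j₀).card : ℝ) ≤ n := by
      rw [hn]; exact_mod_cast Finset.card_le_univ _
    have h2 : ((Finset.univ.erase j₀).card : ℝ) ^ (1 - p / 2) * (s - β j₀) ^ (p / 2) ≤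
        n ^ (1 - p / 2) * (n ^ 2 / 4) ^ (p / 2) := by
      gcongr
      linarith
    have h3 : n ^ (1 - p / 2) * (n ^ 2 / 4) ^ (p / 2) = 2 ^ (-p) * n ^ (1 + p / 2) := by
      rw [show n ^ 2 / 4 = (n * 2⁻¹) ^ 2 by ring, ← Real.rpow_natCast (n * 2⁻¹),
        ← Real.rpow_mul (by positivity), show ((2 : ℕ) : ℝ) * (p / 2) = p by push_cast; ring,
        Real.mul_rpow hn0.le (by norm_num), ← mul_assoc, ← Real.rpow_add hn0,
        Real.inv_rpow zero_le_two, ← Real.rpow_neg zero_le_two, mul_comm]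
      ring_nf
    have h4 : β j₀ ^ (p / 2) ≤ n ^ p := by
      calc β j₀ ^ (p / 2) ≤ (n ^ 2) ^ (p / 2) := by gcongr; exact hβ0 j₀
        _ = n ^ p := by
          rw [← Real.rpow_natCast n, ← Real.rpow_mul hn0.le]; push_cast; ring_nf
    linarith
  exact hsum.trans_le hgoal

theorem SimpleGraph.schattenNorm_rpow_eq_sum_roots {V : Type*} [Fintype V] [DecidableEq V]
    (G : SimpleGraph V) [DecidableRel G.Adj] {p : ℝ} (hp : 1 ≤ p) :
    G.schattenNorm p ^ p =
      ((G.adjMatrix ℂ * G.adjMatrix ℂ).charpoly.roots.map fun z => √z.re ^ p).sum := by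
  have hA : (G.adjMatrix ℂ).conjTranspose = G.adjMatrix ℂ := by
    ext i j
    simp [SimpleGraph.adjMatrix_apply, Matrix.conjTranspose_apply, G.adj_comm]
  have h := sum_singularValues_eq_sum_roots (G.adjMatrix ℂ) fun x => x ^ p
  rw [hA] at h
  rw [G.schattenNorm_rpow hp, ← h]

theorem SimpleGraph.Iso.schattenNorm_rpow_eq {V W : Type*} [Fintype V] [Fintype W]
    {G : SimpleGraph V} {H : SimpleGraph W} (e : G ≃g H) {p : ℝ} (hp : 1 ≤ p) :
    G.schattenNorm p ^ p = H.schattenNorm p ^ p := by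
  classical
  rw [G.schattenNorm_rpow_eq_sum_roots hp, H.schattenNorm_rpow_eq_sum_roots hp,
    ← Matrix.charpoly_reindex e.toEquiv (G.adjMatrix ℂ * G.adjMatrix ℂ)]
  have h : Matrix.reindex e.toEquiv e.toEquiv (G.adjMatrix ℂ) = H.adjMatrix ℂ := by
    ext i j
    have : G.Adj (e.symm i) (e.symm j) ↔ H.Adj i j := e.symm.map_adj_iff
    simp only [Matrix.reindex_apply, Matrix.submatrix_apply, SimpleGraph.adjMatrix_apply]
    exact if_congr this rfl rfl
  rw [← h, Matrix.reindex_apply, Matrix.reindex_apply, Matrix.submatrix_mul_equiv]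

/-- Adding isolated vertices does not change the Schatten norm. -/
theorem SimpleGraph.schattenNorm_rpow_sum_bot {V W : Type*} [Fintype V] [Fintype W]
    (G : SimpleGraph V) {p : ℝ} (hp : 1 ≤ p) :
    (G ⊕g (⊥ : SimpleGraph W)).schattenNorm p ^ p = G.schattenNorm p ^ p := by
  classical
  rw [SimpleGraph.schattenNorm_rpow_eq_sum_roots _ hp, G.schattenNorm_rpow_eq_sum_roots hp]
  have h : (G ⊕g (⊥ : SimpleGraph W)).adjMatrix ℂ =
      Matrix.fromBlocks (G.adjMatrix ℂ) 0 0 0 := by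
    ext (i | i) (j | j) <;> simp [SimpleGraph.adjMatrix_apply]
  rw [h, Matrix.fromBlocks_multiply]
  simp only [Matrix.mul_zero, Matrix.zero_mul, add_zero]
  rw [Matrix.charpoly_fromBlocks_zero₁₂, Polynomial.roots_mul
    (mul_ne_zero (Matrix.charpoly_monic _).ne_zero (Matrix.charpoly_monic _).ne_zero),
    Matrix.charpoly_zero, Polynomial.roots_X_pow]
  simp [Real.zero_rpow (by linarith : p ≠ 0), Multiset.map_nsmul, Multiset.sum_nsmul]

theorem Matrix.charpoly_eq_prod_of_eigenbasis {V ι : Type*} [Fintype V] [DecidableEq V] [Fintype ι]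
    (A : Matrix V V ℂ) (b : Module.Basis ι ℂ (V → ℂ)) (μ : ι → ℂ)
    (h : ∀ i, A.mulVec (b i) = μ i • b i) :
    A.charpoly = ∏ i, (Polynomial.X - Polynomial.C (μ i)) := by
  classical
  rw [← Matrix.charpoly_toLin', ← LinearMap.charpoly_toMatrix _ b, ← Matrix.charpoly_diagonal]
  congr 1
  ext i j
  rw [LinearMap.toMatrix_apply, Matrix.toLin'_apply, h, map_smul, Module.Basis.repr_self,
    Matrix.diagonal_apply]
  by_cases hij : i = j
  · simp [hij]
  · simp [hij]

section Paley

variable {q : ℕ} [Fact q.Prime]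

theorem paleyGraph_adj (hq : q % 4 = 1) (x y : ZMod q) :
    (paleyGraph q).Adj x y ↔ x ≠ y ∧ IsSquare (x - y) := by
  have h1 : IsSquare (-1 : ZMod q) := ZMod.exists_sq_eq_neg_one_iff.2 (by omega)
  have h2 : IsSquare (y - x) ↔ IsSquare (x - y) := by
    constructor <;> intro h <;> simpa using h1.mul h
  simp [paleyGraph, SimpleGraph.fromRel_adj, h2]

/-- The complex-valued quadratic character modulo a prime. -/
noncomputable def complexQuadraticChar (q : ℕ) [Fact q.Prime] : MulChar (ZMod q) ℂ :=
  (quadraticChar (ZMod q)).ringHomComp (Int.castRingHom ℂ)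

open Classical in
theorem paleyGraph_adjMatrix (hq : q % 4 = 1) (x y : ZMod q) :
    (paleyGraph q).adjMatrix ℂ x y =
      (complexQuadraticChar q (x - y) + 1 - if x - y = 0 then 1 else 0) / 2 := by
  rw [SimpleGraph.adjMatrix_apply, paleyGraph_adj hq, complexQuadraticChar,
    MulChar.ringHomComp_apply, quadraticChar_apply, quadraticCharFun, ← sub_ne_zero]
  by_cases h0 : x - y = 0
  · simp [h0]
  · by_cases hs : IsSquare (x - y)
    · simp [h0, hs]
    · simp [h0, hs]

open Classical in
/-- Additive characters are eigenvectors of the Paley graph. -/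
theorem paleyGraph_mulVec_addChar (hq : q % 4 = 1) (ψ : AddChar (ZMod q) ℂ) :
    ((paleyGraph q).adjMatrix ℂ).mulVec ψ =
      ((gaussSum (complexQuadraticChar q) ψ⁻¹ + ∑ z, ψ⁻¹ z - 1) / 2) • (ψ : ZMod q → ℂ) := by
  ext x
  simp only [Matrix.mulVec, dotProduct, Pi.smul_apply, smul_eq_mul]
  rw [← Equiv.sum_comp (Equiv.subLeft x)]
  simp only [paleyGraph_adjMatrix hq, Equiv.subLeft_apply, sub_sub_cancel]
  have h (z : ZMod q) : ψ (x - z) = ψ x * ψ⁻¹ z := by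
    rw [sub_eq_add_neg, AddChar.map_add_eq_mul, AddChar.inv_apply]
  simp only [h]
  calc ∑ z, (complexQuadraticChar q z + 1 - if z = 0 then 1 else 0) / 2 * (ψ x * ψ⁻¹ z)
      = ∑ z, ψ x / 2 * (complexQuadraticChar q z * ψ⁻¹ z + ψ⁻¹ z -
          (if z = 0 then ψ⁻¹ z else 0)) := by
        refine Finset.sum_congr rfl fun z _ => ?_
        split_ifs <;> ring
    _ = _ := by
        rw [← Finset.mul_sum, Finset.sum_sub_distrib, Finset.sum_add_distrib]
        simp [gaussSum]
        ring

theorem gaussSum_complexQuadraticChar_sq (hq : q % 4 = 1) {ψ : AddChar (ZMod q) ℂ} (hψ : ψ ≠ 1) :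
    gaussSum (complexQuadraticChar q) ψ ^ 2 = q := by
  have h2 : ringChar (ZMod q) ≠ 2 := by rw [ZMod.ringChar_zmod_n]; omega
  have hne : complexQuadraticChar q ≠ 1 :=
    (MulChar.ringHomComp_ne_one_iff Int.cast_injective).2 (quadraticChar_ne_one h2)
  rw [gaussSum_sq hne ((quadraticChar_isQuadratic _).comp _) (AddChar.IsPrimitive.of_ne_one hψ)]
  have h1 : IsSquare (-1 : ZMod q) := ZMod.exists_sq_eq_neg_one_iff.2 (by omega)
  have h3 : quadraticChar (ZMod q) (-1) = 1 :=
    (quadraticChar_one_iff_isSquare (neg_ne_zero.2 one_ne_zero)).2 h1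
  simp [complexQuadraticChar, MulChar.ringHomComp_apply, h3, ZMod.card]

theorem paleyGraph_schattenNorm_ge (hq : q % 4 = 1) {p : ℝ} (hp : 1 ≤ p) :
    ((q : ℝ) - 1) * ((√q - 1) / 2) ^ p ≤ (paleyGraph q).schattenNorm p ^ p := by
  classical
  set A := (paleyGraph q).adjMatrix ℂ with hA
  set μ : AddChar (ZMod q) ℂ → ℂ := fun ψ =>
    (gaussSum (complexQuadraticChar q) ψ⁻¹ + ∑ z, ψ⁻¹ z - 1) / 2 with hμ
  have hq1 : (1 : ℝ) ≤ q := by exact_mod_cast (Fact.out : q.Prime).one_lt.le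
  have hcard : Fintype.card (AddChar (ZMod q) ℂ) = q := by rw [AddChar.card_eq, ZMod.card]
  let b := basisOfLinearIndependentOfCardEqFinrank (AddChar.linearIndependent (ZMod q) ℂ)
    (by rw [AddChar.card_eq, Module.finrank_fintype_fun_eq_card])
  have hb (ψ) : b ψ = (ψ : ZMod q → ℂ) := by
    simp [b]
  have hchar : (A * A).charpoly = ∏ ψ, (Polynomial.X - Polynomial.C (μ ψ ^ 2)) := by
    refine Matrix.charpoly_eq_prod_of_eigenbasis _ b _ fun ψ => ?_
    rw [hb, ← Matrix.mulVec_mulVec, hA, paleyGraph_mulVec_addChar hq, Matrix.mulVec_smul,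
      paleyGraph_mulVec_addChar hq, smul_smul, sq]
  rw [SimpleGraph.schattenNorm_rpow_eq_sum_roots _ hp, ← hA, hchar,
    Polynomial.roots_prod _ _ (Finset.prod_ne_zero_iff.2 fun i _ =>
      Polynomial.X_sub_C_ne_zero _)]
  simp only [Polynomial.roots_X_sub_C, Multiset.bind_singleton, Multiset.map_map]
  change _ ≤ ∑ ψ, √(μ ψ ^ 2).re ^ p
  have hs1 : 1 ≤ √(q : ℝ) := Real.one_le_sqrt.2 hq1
  have hμ1 (ψ : AddChar (ZMod q) ℂ) (hψ : ψ ≠ 1) : (√q - 1) / 2 ≤ √(μ ψ ^ 2).re := by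
    have hψ' : ψ⁻¹ ≠ 1 := inv_ne_one.2 hψ
    have h1 := gaussSum_complexQuadraticChar_sq hq hψ'
    have h2 : gaussSum (complexQuadraticChar q) ψ⁻¹ = (√(q : ℝ) : ℝ) ∨
        gaussSum (complexQuadraticChar q) ψ⁻¹ = (-√(q : ℝ) : ℝ) := by
      have : ((√(q : ℝ) : ℝ) : ℂ) ^ 2 = q := by
        rw [← Complex.ofReal_pow, Real.sq_sqrt (by positivity)]; simp
      rw [← this] at h1
      simpa using sq_eq_sq_iff_eq_or_eq_neg.1 h1
    simp only [hμ, AddChar.sum_eq_zero_of_ne_one hψ', add_zero]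
    refine Real.le_sqrt_of_sq_le ?_
    rcases h2 with h | h <;> rw [h]
    · rw [← Complex.ofReal_one, ← Complex.ofReal_sub, ← Complex.ofReal_ofNat,
        ← Complex.ofReal_div, ← Complex.ofReal_pow, Complex.ofReal_re]
    · rw [← Complex.ofReal_one, ← Complex.ofReal_sub, ← Complex.ofReal_ofNat,
        ← Complex.ofReal_div, ← Complex.ofReal_pow, Complex.ofReal_re]
      nlinarith
  calc ((q : ℝ) - 1) * ((√q - 1) / 2) ^ p
      = ∑ ψ ∈ Finset.univ.erase (1 : AddChar (ZMod q) ℂ), ((√q - 1) / 2) ^ p := by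
        rw [Finset.sum_const, Finset.card_erase_of_mem (Finset.mem_univ _), Finset.card_univ, hcard,
          nsmul_eq_mul, Nat.cast_sub (Fact.out : q.Prime).one_lt.le, Nat.cast_one]
    _ ≤ ∑ ψ ∈ Finset.univ.erase (1 : AddChar (ZMod q) ℂ), √(μ ψ ^ 2).re ^ p := by
        refine Finset.sum_le_sum fun ψ hψ => ?_
        exact Real.rpow_le_rpow (by linarith) (hμ1 ψ (Finset.ne_of_mem_erase hψ)) (by linarith)
    _ ≤ _ := Finset.sum_le_sum_of_subset_of_nonneg (Finset.erase_subset _ _)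
        fun _ _ _ => by positivity

end Paley

/-- The Fejér kernel, as the Fourier transform of a triangle function supported on `[-T, T]`. -/
noncomputable def fejerKernel (T v : ℝ) : ℝ := ∫ t in (0 : ℝ)..T, 2 * (1 - t / T) * Real.cos (t * v)

theorem fejerKernel_eq {T v : ℝ} (hT : T ≠ 0) (hv : v ≠ 0) :
    fejerKernel T v = 2 * (1 - Real.cos (T * v)) / (T * v ^ 2) := by
  have h (t : ℝ) : HasDerivAt (fun t => 2 * ((1 - t / T) * (Real.sin (t * v) / v) -
      Real.cos (t * v) / (T * v ^ 2))) (2 * (1 - t / T) * Real.cos (t * v)) t := by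
    have h1 : HasDerivAt (fun t => 1 - t / T) (-(1 / T)) t :=
      ((hasDerivAt_id t).div_const T).const_sub 1
    have h2 : HasDerivAt (fun t => t * v) v t := by simpa using (hasDerivAt_id t).mul_const v
    refine (((h1.mul (h2.sin.div_const v)).sub (h2.cos.div_const (T * v ^ 2))).const_mul
      2).congr_deriv ?_
    field_simp
    ring
  rw [fejerKernel, intervalIntegral.integral_eq_sub_of_hasDerivAt (fun t _ => h t)
    (by apply Continuous.intervalIntegrable; fun_prop)]
  simp only [zero_mul, Real.sin_zero, Real.cos_zero]
  field_simp
  ring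

theorem fejerKernel_zero {T : ℝ} (hT : T ≠ 0) : fejerKernel T 0 = T := by
  have h (t : ℝ) : HasDerivAt (fun t => 2 * t - t ^ 2 / T) (2 * (1 - t / T)) t := by
    refine (((hasDerivAt_id t).const_mul 2).sub
      (((hasDerivAt_id t).pow 2).div_const T)).congr_deriv ?_
    simp
    ring
  simp only [fejerKernel, mul_zero, Real.cos_zero, mul_one]
  rw [intervalIntegral.integral_eq_sub_of_hasDerivAt (fun t _ => h t)
    (by apply Continuous.intervalIntegrable; fun_prop)]
  field_simp
  ring

theorem fejerKernel_nonneg {T : ℝ} (hT : 0 < T) (v : ℝ) : 0 ≤ fejerKernel T v := by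
  rcases eq_or_ne v 0 with rfl | hv
  · rw [fejerKernel_zero hT.ne']; exact hT.le
  · rw [fejerKernel_eq hT.ne' hv]
    have := Real.cos_le_one (T * v)
    have : 0 ≤ 1 - Real.cos (T * v) := by linarith
    positivity

theorem fejerKernel_le {T : ℝ} (hT : 0 < T) (v : ℝ) : fejerKernel T v ≤ T := by
  rcases eq_or_ne v 0 with rfl | hv
  · rw [fejerKernel_zero hT.ne']
  · rw [fejerKernel_eq hT.ne' hv, div_le_iff₀ (by positivity)]
    have := Real.one_sub_sq_div_two_le_cos (x := T * v)
    nlinarith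

theorem fejerKernel_le_div_sq {T v : ℝ} (hT : 0 < T) (hv : v ≠ 0) :
    fejerKernel T v ≤ 4 / (T * v ^ 2) := by
  rw [fejerKernel_eq hT.ne' hv]
  have := Real.neg_one_le_cos (T * v)
  gcongr
  linarith

theorem div_four_le_fejerKernel {T v : ℝ} (hT : 0 < T) (hv : |v| ≤ 1 / T) :
    T / 4 ≤ fejerKernel T v := by
  rcases eq_or_ne v 0 with rfl | hv0
  · rw [fejerKernel_zero hT.ne']; linarith
  · rw [fejerKernel_eq hT.ne' hv0, le_div_iff₀ (by positivity)]
    set x := T * v with hx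
    have hx1 : |x| ≤ 1 := by
      rw [hx, abs_mul, abs_of_pos hT]
      rwa [le_div_iff₀ hT, mul_comm] at hv
    have h1 := Real.cos_le_one_sub_mul_cos_sq (hx1.trans (by linarith [Real.pi_gt_three]))
    have h2 : 1 / 8 ≤ 2 / Real.pi ^ 2 := by
      rw [div_le_div_iff₀ (by norm_num) (by positivity)]
      nlinarith [Real.pi_pos, Real.pi_lt_four]
    have h3 : T / 4 * (T * v ^ 2) = x ^ 2 / 4 := by rw [hx]; ring
    rw [h3]
    nlinarith [sq_nonneg x]

theorem continuous_fejerKernel (T : ℝ) : Continuous (fejerKernel T) := by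
  unfold fejerKernel
  apply intervalIntegral.continuous_parametric_intervalIntegral_of_continuous' (by fun_prop)

open ArithmeticFunction in
theorem sum_vonMangoldt_le_psi {s : Finset ℕ} {x : ℝ} (hs : ∀ n ∈ s, (n : ℝ) ≤ x) :
    ∑ n ∈ s, vonMangoldt n ≤ Chebyshev.psi x := by
  rw [← Finset.sum_erase s (a := 0) (by simp), Chebyshev.psi]
  refine Finset.sum_le_sum_of_subset_of_nonneg (fun n hn => ?_) fun _ _ _ => vonMangoldt_nonneg
  rw [Finset.mem_erase] at hn
  exact Finset.mem_Ioc.2 ⟨Nat.pos_of_ne_zero hn.1, Nat.le_floor (hs n hn.2)⟩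

theorem summable_int_one_div_one_add_sq : Summable fun k : ℤ => 1 / (1 + (k : ℝ) ^ 2) := by
  refine Summable.of_norm_bounded_eventually (g := fun k : ℤ => 1 / (k : ℝ) ^ 2)
    (Real.summable_one_div_int_pow.2 one_lt_two) ?_
  filter_upwards [(Set.finite_singleton (0 : ℤ)).compl_mem_cofinite] with k hk
  have hk' : (k : ℝ) ≠ 0 := by simpa using hk
  rw [Real.norm_of_nonneg (by positivity)]
  gcongr
  linarith

open ArithmeticFunction in
/-- Chebyshev's upper bound, as a bound for smoothed logarithmic sums over `Λ`. -/
theorem exists_sum_vonMangoldt_div_le : ∃ C : ℝ, 0 ≤ C ∧ ∀ (y : ℝ) (s : Finset ℕ),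
    ∑ n ∈ s, vonMangoldt n / n * (1 / (1 + (Real.log n - y) ^ 2)) ≤ C := by
  set c : ℝ := Real.log 4 + 4
  have hc : 0 ≤ c := by positivity
  set D : ℝ := c * Real.exp 1 * 3
  have hD : 0 ≤ D := by positivity
  refine ⟨D * ∑' k : ℤ, 1 / (1 + (k : ℝ) ^ 2),
    mul_nonneg hD (tsum_nonneg fun k => by positivity), fun y s => ?_⟩
  rw [← Finset.sum_fiberwise_of_maps_to (t := s.image fun n : ℕ => ⌊Real.log n - y⌋)
    (g := fun n : ℕ => ⌊Real.log n - y⌋) (fun n hn => Finset.mem_image_of_mem _ hn)]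
  rw [← tsum_mul_left]
  refine le_trans (Finset.sum_le_sum fun k _ => ?_) ((summable_int_one_div_one_add_sq.mul_left
    D).sum_le_tsum _ fun k _ => by positivity)
  set s' := s.filter fun n : ℕ => ⌊Real.log n - y⌋ = k
  have hs' (n : ℕ) (hn : n ∈ s') : k ≤ Real.log n - y ∧ Real.log n - y < k + 1 :=
    Int.floor_eq_iff.1 (Finset.mem_filter.1 hn).2
  have hterm (n : ℕ) (hn : n ∈ s') : vonMangoldt n / n * (1 / (1 + (Real.log n - y) ^ 2)) ≤
      vonMangoldt n * (Real.exp (-(y + k)) * (3 / (1 + (k : ℝ) ^ 2))) := by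
    rcases Nat.eq_zero_or_pos n with rfl | hn0
    · simp
    have hn0' : (0 : ℝ) < n := by exact_mod_cast hn0
    obtain ⟨h1, h2⟩ := hs' n hn
    rw [div_eq_mul_inv, mul_assoc]
    refine mul_le_mul_of_nonneg_left ?_ vonMangoldt_nonneg
    refine mul_le_mul ?_ ?_ (by positivity) (by positivity)
    · rw [Real.exp_neg]
      refine inv_anti₀ (Real.exp_pos _) ?_
      rw [← Real.le_log_iff_exp_le hn0']
      linarith
    · rw [div_le_div_iff₀ (by positivity) (by positivity)]
      set u := Real.log n - y
      nlinarith [sq_nonneg (u + (u - k)), sq_nonneg (u - k)]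
  calc _ ≤ ∑ n ∈ s', vonMangoldt n * (Real.exp (-(y + k)) * (3 / (1 + (k : ℝ) ^ 2))) :=
        Finset.sum_le_sum hterm
    _ = (∑ n ∈ s', vonMangoldt n) * (Real.exp (-(y + k)) * (3 / (1 + (k : ℝ) ^ 2))) :=
        (Finset.sum_mul ..).symm
    _ ≤ (c * Real.exp (y + k + 1)) * (Real.exp (-(y + k)) * (3 / (1 + (k : ℝ) ^ 2))) := by
        gcongr
        refine (sum_vonMangoldt_le_psi fun n hn => ?_).trans
          (Chebyshev.psi_le_const_mul_self (Real.exp_pos _).le)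
        rcases Nat.eq_zero_or_pos n with rfl | hn0
        · simpa using (Real.exp_pos _).le
        · rw [← Real.log_le_iff_le_exp (by exact_mod_cast hn0)]
          linarith [(hs' n hn).2]
    _ = D * (1 / (1 + (k : ℝ) ^ 2)) := by
        have : Real.exp (y + k + 1) * Real.exp (-(y + k)) = Real.exp 1 := by
          rw [← Real.exp_add]; ring_nf
        simp only [D]
        rw [← this]; ring

theorem cexp_mul_term_eq (f : ℕ → ℝ) {σ : ℝ} (hσ : σ ≠ 0) (t y : ℝ) (n : ℕ) :
    Complex.exp (t * y * Complex.I) *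
      LSeries.term (fun n => (f n : ℂ)) (σ + t * Complex.I) n =
    ((f n * (n : ℝ) ^ (-σ) : ℝ) : ℂ) *
      Complex.exp ((-(t * (Real.log n - y)) : ℝ) * Complex.I) := by
  rcases eq_or_ne n 0 with rfl | hn
  · simp [Real.zero_rpow (neg_ne_zero.2 hσ)]
  have hn0 : (0 : ℝ) < n := by exact_mod_cast Nat.pos_of_ne_zero hn
  rw [LSeries.term_of_ne_zero hn, Complex.cpow_def_of_ne_zero (by exact_mod_cast hn),
    ← Complex.natCast_log, Real.rpow_def_of_pos hn0, div_eq_mul_inv, ← Complex.exp_neg,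
    mul_left_comm, ← Complex.exp_add, Complex.ofReal_mul, Complex.ofReal_exp,
    mul_assoc (f n : ℂ), ← Complex.exp_add]
  congr 2
  push_cast
  ring

theorem re_ofReal_mul_cexp (c x : ℝ) :
    ((c : ℂ) * Complex.exp ((x : ℂ) * Complex.I)).re = c * Real.cos x := by
  rw [Complex.re_ofReal_mul, Complex.exp_ofReal_mul_I_re]

/-- The weight `2 (1 - t / T) e ^ (i t y)`. -/
noncomputable def fejerWeight (T y t : ℝ) : ℂ :=
  ((2 * (1 - t / T) : ℝ) : ℂ) * Complex.exp (t * y * Complex.I)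

theorem continuous_fejerWeight (T y : ℝ) : Continuous (fejerWeight T y) := by
  unfold fejerWeight
  fun_prop

theorem norm_fejerWeight_le {T t : ℝ} (hT : 0 < T) (y : ℝ) (ht : t ∈ Set.uIoc 0 T) :
    ‖fejerWeight T y t‖ ≤ 2 := by
  rw [Set.uIoc_of_le hT.le] at ht
  rw [fejerWeight, norm_mul, ← Complex.ofReal_mul, Complex.norm_exp_ofReal_mul_I, mul_one,
    Complex.norm_real, Real.norm_eq_abs, abs_le]
  have h1 : 0 < t / T := div_pos ht.1 hT
  have h2 : t / T ≤ 1 := (div_le_one hT).2 ht.2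
  constructor <;> linarith

theorem hasSum_mul_fejerKernel (f : ℕ → ℝ) {σ T : ℝ} (hσ : 0 < σ) (hT : 0 < T) (y : ℝ)
    (hf : LSeriesSummable (fun n => (f n : ℂ)) σ) :
    HasSum (fun n : ℕ => f n * (n : ℝ) ^ (-σ) * fejerKernel T (Real.log n - y))
      (∫ t in (0 : ℝ)..T, fejerWeight T y t *
        LSeries (fun n => (f n : ℂ)) (σ + t * Complex.I)).re := by
  have hF (n : ℕ) (t : ℝ) : fejerWeight T y t *
      LSeries.term (fun n => (f n : ℂ)) (σ + t * Complex.I) n =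
      ((2 * (1 - t / T) * (f n * (n : ℝ) ^ (-σ)) : ℝ) : ℂ) *
        Complex.exp ((-(t * (Real.log n - y)) : ℝ) * Complex.I) := by
    rw [fejerWeight, mul_assoc, cexp_mul_term_eq f hσ.ne', Complex.ofReal_mul (2 * (1 - t / T)),
      mul_assoc]
  have hcont (n : ℕ) : Continuous fun t : ℝ => fejerWeight T y t *
      LSeries.term (fun n => (f n : ℂ)) (σ + t * Complex.I) n := by
    simp only [hF]
    fun_prop
  have hnorm (n : ℕ) (t : ℝ) : ‖LSeries.term (fun n => (f n : ℂ)) (σ + t * Complex.I) n‖ =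
      ‖LSeries.term (fun n => (f n : ℂ)) σ n‖ := by
    simp [LSeries.norm_term_eq]
  have hsum := intervalIntegral.hasSum_integral_of_dominated_convergence (a := 0) (b := T)
    (μ := MeasureTheory.volume)
    (F := fun (n : ℕ) (t : ℝ) => fejerWeight T y t *
      LSeries.term (fun n => (f n : ℂ)) (σ + t * Complex.I) n)
    (f := fun t => fejerWeight T y t * LSeries (fun n => (f n : ℂ)) (σ + t * Complex.I))
    (fun n _ => 2 * ‖LSeries.term (fun n => (f n : ℂ)) σ n‖)
    (fun n => (hcont n).aestronglyMeasurable)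
    (fun n => Eventually.of_forall fun t ht => by
      rw [norm_mul, hnorm]
      gcongr
      exact norm_fejerWeight_le hT y ht)
    (Eventually.of_forall fun t _ => hf.norm.mul_left 2)
    intervalIntegrable_const
    (Eventually.of_forall fun t _ => by
      refine HasSum.mul_left _ (Summable.hasSum ?_)
      exact Summable.of_norm (by simpa only [hnorm] using hf.norm))
  convert Complex.hasSum_re hsum using 2 with n
  rw [← Complex.reCLM_apply, ← Complex.reCLM.intervalIntegral_comp_comm
    ((hcont n).intervalIntegrable _ _), fejerKernel, ← intervalIntegral.integral_const_mul]
  refine intervalIntegral.integral_congr fun t _ => ?_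
  simp only [Complex.reCLM_apply, hF, re_ofReal_mul_cexp, Real.cos_neg]
  ring

theorem integral_exp_mul_fejerKernel {c T : ℝ} (hc : 0 < c) (hT : 0 < T) (y : ℝ) :
    ∫ u in Set.Ioi (0 : ℝ), Real.exp (-c * u) * fejerKernel T (u - y) =
      (∫ t in (0 : ℝ)..T, fejerWeight T y t * (1 / (c + t * Complex.I))).re := by
  have hF (t u : ℝ) : fejerWeight T y t * Complex.exp (-(c + t * Complex.I) * u) =
      ((Real.exp (-c * u) * (2 * (1 - t / T)) : ℝ) : ℂ) *
        Complex.exp ((-(t * (u - y)) : ℝ) * Complex.I) := by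
    rw [fejerWeight, mul_assoc, ← Complex.exp_add, mul_comm (Real.exp _), Complex.ofReal_mul _
      (Real.exp _), Complex.ofReal_exp, mul_assoc (Complex.ofReal (2 * _)),
      ← Complex.exp_add]
    congr 2
    push_cast
    ring
  have hinner (t : ℝ) : fejerWeight T y t * (1 / (c + t * Complex.I)) =
      ∫ u in Set.Ioi (0 : ℝ), fejerWeight T y t * Complex.exp (-(c + t * Complex.I) * u) := by
    rw [MeasureTheory.integral_const_mul, integral_exp_mul_complex_Ioi (by simpa using hc)]
    simp only [Complex.ofReal_zero, mul_zero, Complex.exp_zero, neg_div_neg_eq]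
  have hcont : Continuous fun z : ℝ × ℝ =>
      fejerWeight T y z.1 * Complex.exp (-(c + z.1 * Complex.I) * z.2) := by
    unfold fejerWeight
    fun_prop
  have hint : MeasureTheory.Integrable
      (Function.uncurry fun t u : ℝ => fejerWeight T y t * Complex.exp (-(c + t * Complex.I) * u))
      ((MeasureTheory.volume.restrict (Set.uIoc 0 T)).prod
        (MeasureTheory.volume.restrict (Set.Ioi 0))) := by
    have h1 : MeasureTheory.Integrable (fun _ : ℝ => (2 : ℝ))
        (MeasureTheory.volume.restrict (Set.uIoc 0 T)) := by
      rw [Set.uIoc_of_le hT.le]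
      exact MeasureTheory.integrable_const _
    have h2 := h1.mul_prod (exp_neg_integrableOn_Ioi 0 hc)
    refine h2.mono' hcont.aestronglyMeasurable ?_
    rw [MeasureTheory.Measure.prod_restrict]
    refine (MeasureTheory.ae_restrict_iff' (measurableSet_uIoc.prod measurableSet_Ioi)).2
      (Eventually.of_forall fun z hz => ?_)
    simp only [Function.uncurry]
    rw [norm_mul, Complex.norm_exp]
    have : (-(c + z.1 * Complex.I) * z.2 : ℂ).re = -c * z.2 := by simp
    rw [this]
    gcongr
    exact norm_fejerWeight_le hT y hz.1
  simp only [hinner]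
  rw [MeasureTheory.intervalIntegral_integral_swap hint]
  have hint2 := hint.integral_prod_right
  have hre := integral_re (𝕜 := ℂ) hint2
  simp only [Function.uncurry, RCLike.re_eq_complex_re] at hre
  have heq : ∀ u : ℝ, (∫ t in (0 : ℝ)..T,
      fejerWeight T y t * Complex.exp (-(c + t * Complex.I) * u)).re =
      Real.exp (-c * u) * fejerKernel T (u - y) := by
    intro u
    rw [← Complex.reCLM_apply, ← Complex.reCLM.intervalIntegral_comp_comm
      (by
        apply Continuous.intervalIntegrable
        have := continuous_fejerWeight T y
        fun_prop), fejerKernel, ← intervalIntegral.integral_const_mul]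
    refine intervalIntegral.integral_congr fun t _ => ?_
    simp only [Complex.reCLM_apply, hF, re_ofReal_mul_cexp, Real.cos_neg]
    ring
  simp only [intervalIntegral.integral_of_le hT.le, Set.uIoc_of_le hT.le] at hre heq ⊢
  rw [← hre]
  simp only [heq]

/-- A lower bound for the contribution of the pole. -/
theorem le_integral_exp_mul_fejerKernel {c T y : ℝ} (hc : 0 < c) (hT : 1 ≤ T) (hy : 1 ≤ y) :
    Real.exp (-c * (y + 1)) / 2 ≤
      ∫ u in Set.Ioi (0 : ℝ), Real.exp (-c * u) * fejerKernel T (u - y) := by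
  have hT0 : 0 < T := by linarith
  have hT1 : 1 / T ≤ 1 := (div_le_one hT0).2 hT
  have hTp : 0 < 1 / T := by positivity
  have hcont : Continuous fun u => Real.exp (-c * u) * fejerKernel T (u - y) := by
    have := continuous_fejerKernel T
    fun_prop
  have hint : MeasureTheory.IntegrableOn (fun u => Real.exp (-c * u) * fejerKernel T (u - y))
      (Set.Ioi 0) := by
    refine MeasureTheory.Integrable.mono' ((exp_neg_integrableOn_Ioi 0 hc).mul_const T)
      hcont.aestronglyMeasurable (Eventually.of_forall fun u => ?_)
    rw [Real.norm_of_nonneg (mul_nonneg (Real.exp_pos _).le (fejerKernel_nonneg hT0 _))]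
    gcongr
    exact fejerKernel_le hT0 _
  have hsub : Set.Ioc (y - 1 / T) (y + 1 / T) ⊆ Set.Ioi 0 := fun u hu => by
    have := hu.1
    simp only [Set.mem_Ioi]
    linarith
  calc Real.exp (-c * (y + 1)) / 2
      = ∫ u in (y - 1 / T)..(y + 1 / T), Real.exp (-c * (y + 1)) * (T / 4) := by
        rw [intervalIntegral.integral_const, smul_eq_mul]
        field_simp
        ring
    _ ≤ ∫ u in (y - 1 / T)..(y + 1 / T), Real.exp (-c * u) * fejerKernel T (u - y) := by
        refine intervalIntegral.integral_mono_on (by linarith) intervalIntegrable_const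
          (hcont.intervalIntegrable _ _) fun u hu => ?_
        refine mul_le_mul ?_ (div_four_le_fejerKernel hT0 ?_) (by positivity) (by positivity)
        · refine Real.exp_le_exp.2 ?_
          nlinarith [hu.2]
        · rw [abs_le]
          constructor <;> linarith [hu.1, hu.2]
    _ ≤ _ := by
        rw [intervalIntegral.integral_of_le (by linarith)]
        refine MeasureTheory.setIntegral_mono_set hint
          (Eventually.of_forall fun u => ?_) hsub.eventuallyLE
        exact mul_nonneg (Real.exp_pos _).le (fejerKernel_nonneg hT0 _)

/-- The Riemann–Lebesgue lemma against the Fejér weight. -/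
theorem tendsto_integral_fejerWeight_mul (T : ℝ) (hT : 0 ≤ T) (g : ℝ → ℂ) :
    Tendsto (fun y => ∫ t in (0 : ℝ)..T, fejerWeight T y t * g t) atTop (𝓝 0) := by
  have h := Real.tendsto_integral_exp_smul_cocompact
    ((Set.Ioc 0 T).indicator fun t => ((2 * (1 - t / T) : ℝ) : ℂ) * g t)
  have hw : Tendsto (fun y : ℝ => -(y / (2 * Real.pi))) atTop (cocompact ℝ) := by
    refine (tendsto_neg_atTop_atBot.comp (tendsto_id.atTop_div_const (by positivity))).mono_right ?_
    exact atBot_le_cocompact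
  refine (h.comp hw).congr fun y => ?_
  rw [intervalIntegral.integral_of_le hT, ← MeasureTheory.integral_indicator measurableSet_Ioc]
  refine MeasureTheory.integral_congr_ae (Eventually.of_forall fun t => ?_)
  by_cases ht : t ∈ Set.Ioc 0 T
  · simp only [Set.indicator_of_mem ht, Circle.smul_def, Real.fourierChar_apply, smul_eq_mul,
      fejerWeight]
    have : ((2 * Real.pi * -(t * -(y / (2 * Real.pi))) : ℝ) : ℂ) = t * y := by
      rw [← Complex.ofReal_mul]
      congr 1
      field_simp
    rw [this]
    ring
  · simp [Set.indicator_of_notMem ht]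

/-- The natural numbers whose logarithm is within `δ` of `y`. -/
noncomputable def natsLogNear (y δ : ℝ) : Finset ℕ :=
  {n ∈ Finset.range (⌊Real.exp (y + δ)⌋₊ + 1) | |Real.log n - y| ≤ δ}

theorem mem_natsLogNear {y δ : ℝ} {n : ℕ} (hn : n ≠ 0) :
    n ∈ natsLogNear y δ ↔ |Real.log n - y| ≤ δ := by
  rw [natsLogNear, Finset.mem_filter, and_iff_right_iff_imp]
  intro h
  rw [Finset.mem_range, Nat.lt_succ_iff]
  refine Nat.le_floor ?_
  rw [← Real.log_le_iff_le_exp (by exact_mod_cast Nat.pos_of_ne_zero hn)]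
  linarith [(abs_le.1 h).2]

open ArithmeticFunction

theorem sum_residueClass_mul_fejerKernel_le {C : ℝ} (hC : ∀ (y : ℝ) (s : Finset ℕ),
    ∑ n ∈ s, vonMangoldt n / n * (1 / (1 + (Real.log n - y) ^ 2)) ≤ C) {q : ℕ} (a : ZMod q)
    {σ T δ : ℝ} (hσ : 1 ≤ σ) (hT : 0 < T) (hδ : 0 < δ) (y : ℝ) (s : Finset ℕ) :
    ∑ n ∈ s, vonMangoldt.residueClass a n * (n : ℝ) ^ (-σ) * fejerKernel T (Real.log n - y) ≤
      T * ∑ n ∈ natsLogNear y δ, vonMangoldt.residueClass a n / n +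
        4 * (1 + 1 / δ ^ 2) / T * C := by
  have hr0 (n : ℕ) : 0 ≤ vonMangoldt.residueClass a n := vonMangoldt.residueClass_nonneg a n
  have hpow (n : ℕ) : vonMangoldt.residueClass a n * (n : ℝ) ^ (-σ) ≤
      vonMangoldt.residueClass a n / n := by
    rcases Nat.eq_zero_or_pos n with rfl | hn
    · simp
    · rw [div_eq_mul_inv]
      refine mul_le_mul_of_nonneg_left ?_ (hr0 n)
      rw [← Real.rpow_neg_one]
      exact Real.rpow_le_rpow_of_exponent_le (by exact_mod_cast hn) (by linarith)
  have h1 (n : ℕ) : vonMangoldt.residueClass a n * (n : ℝ) ^ (-σ) *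
      fejerKernel T (Real.log n - y) ≤
      vonMangoldt.residueClass a n / n * fejerKernel T (Real.log n - y) :=
    mul_le_mul_of_nonneg_right (hpow n) (fejerKernel_nonneg hT _)
  refine (Finset.sum_le_sum fun n _ => h1 n).trans ?_
  rw [← Finset.sum_filter_add_sum_filter_not s (· ∈ natsLogNear y δ)]
  refine add_le_add ?_ ?_
  · rw [Finset.mul_sum]
    calc _ ≤ ∑ n ∈ s with n ∈ natsLogNear y δ, T * (vonMangoldt.residueClass a n / n) := by
          refine Finset.sum_le_sum fun n _ => ?_
          rw [mul_comm]
          exact mul_le_mul_of_nonneg_right (fejerKernel_le hT _)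
            (div_nonneg (hr0 n) n.cast_nonneg)
      _ ≤ _ := Finset.sum_le_sum_of_subset_of_nonneg
          (fun n hn => (Finset.mem_filter.1 hn).2)
          fun n _ _ => mul_nonneg hT.le (div_nonneg (hr0 n) n.cast_nonneg)
  · refine le_trans ?_ (mul_le_mul_of_nonneg_left
      (hC y (s.filter (· ∉ natsLogNear y δ))) (by positivity))
    rw [Finset.mul_sum]
    refine Finset.sum_le_sum fun n hn => ?_
    rcases eq_or_ne n 0 with rfl | hn0
    · simp
    have hv := (Finset.mem_filter.1 hn).2
    rw [mem_natsLogNear hn0, not_le] at hv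
    set v := Real.log n - y
    have hv0 : v ≠ 0 := by
      rintro h
      rw [h, abs_zero] at hv
      linarith
    have hvδ : δ ^ 2 ≤ v ^ 2 := by
      rw [← sq_abs v]
      gcongr
    have hF : fejerKernel T v ≤ 4 * (1 + 1 / δ ^ 2) / T * (1 / (1 + v ^ 2)) := by
      refine (fejerKernel_le_div_sq hT hv0).trans ?_
      have : 1 + v ^ 2 ≤ (1 + 1 / δ ^ 2) * v ^ 2 := by
        have : 1 ≤ v ^ 2 / δ ^ 2 := (one_le_div (by positivity)).2 hvδ
        calc 1 + v ^ 2 ≤ v ^ 2 / δ ^ 2 + v ^ 2 := by linarith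
          _ = _ := by ring
      rw [div_mul_div_comm, mul_one, div_le_div_iff₀ (by positivity) (by positivity)]
      nlinarith
    calc _ ≤ vonMangoldt n / n * (4 * (1 + 1 / δ ^ 2) / T * (1 / (1 + v ^ 2))) := by
          refine mul_le_mul ?_ hF (fejerKernel_nonneg hT _)
            (div_nonneg vonMangoldt_nonneg n.cast_nonneg)
          exact div_le_div_of_nonneg_right (vonMangoldt.residueClass_le a n) n.cast_nonneg
      _ = _ := by ring

/-- The smoothed inequality behind the Wiener–Ikehara theorem. -/
theorem le_sum_residueClass_natsLogNear {C : ℝ} (hC : ∀ (y : ℝ) (s : Finset ℕ),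
    ∑ n ∈ s, vonMangoldt n / n * (1 / (1 + (Real.log n - y) ^ 2)) ≤ C) {q : ℕ} [NeZero q]
    {a : ZMod q} (ha : IsUnit a) {T δ y : ℝ} (hT : 1 ≤ T) (hδ : 0 < δ) (hy : 1 ≤ y) :
    (q.totient : ℝ)⁻¹ / 2 + (∫ t in (0 : ℝ)..T, fejerWeight T y t *
        vonMangoldt.LFunctionResidueClassAux a (1 + t * Complex.I)).re ≤
      T * ∑ n ∈ natsLogNear y δ, vonMangoldt.residueClass a n / n +
        4 * (1 + 1 / δ ^ 2) / T * C := by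
  have hT0 : 0 < T := by linarith
  set H : ℝ → ℝ → ℂ := fun σ t =>
    vonMangoldt.LFunctionResidueClassAux a ((max σ 1 : ℝ) + t * Complex.I) with hH
  have hHcont : Continuous (Function.uncurry H) := by
    refine (vonMangoldt.continuousOn_LFunctionResidueClassAux a).comp_continuous
      (f := fun z : ℝ × ℝ => ((max z.1 1 : ℝ) + z.2 * Complex.I : ℂ)) (by fun_prop) fun z => ?_
    simp
  have hwH : Continuous (Function.uncurry fun σ t => fejerWeight T y t * H σ t) :=
    ((continuous_fejerWeight T y).comp continuous_snd).mul hHcont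
  have hΦ : Continuous fun σ : ℝ => ∫ t in (0 : ℝ)..T, fejerWeight T y t * H σ t :=
    intervalIntegral.continuous_parametric_intervalIntegral_of_continuous' hwH 0 T
  have hσ (σ : ℝ) (hσ : 1 < σ) : (q.totient : ℝ)⁻¹ * (Real.exp (-(σ - 1) * (y + 1)) / 2) +
      (∫ t in (0 : ℝ)..T, fejerWeight T y t * H σ t).re ≤
      T * ∑ n ∈ natsLogNear y δ, vonMangoldt.residueClass a n / n +
        4 * (1 + 1 / δ ^ 2) / T * C := by
    have hsummable : LSeriesSummable (fun n => (vonMangoldt.residueClass a n : ℂ)) σ :=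
      LSeriesSummable_of_abscissaOfAbsConv_lt_re <|
        (vonMangoldt.abscissaOfAbsConv_residueClass_le_one a).trans_lt <| by
          rw [Complex.ofReal_re]; exact_mod_cast hσ
    have hS := hasSum_mul_fejerKernel (vonMangoldt.residueClass a) (by linarith) hT0 y hsummable
    have hle := hasSum_le_of_sum_le hS fun s =>
      sum_residueClass_mul_fejerKernel_le hC a hσ.le hT0 hδ y s
    have hc : 0 < σ - 1 := by linarith
    have hpole := (le_integral_exp_mul_fejerKernel hc hT hy).trans_eq
      (integral_exp_mul_fejerKernel hc hT0 y)
    have hcont2 : Continuous fun t : ℝ =>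
        fejerWeight T y t * (1 / (((σ - 1 : ℝ) : ℂ) + t * Complex.I)) := by
      refine (continuous_fejerWeight T y).mul (continuous_const.div (by fun_prop) fun t h => ?_)
      have := congrArg Complex.re h
      simp at this
      linarith
    have hsplit (t : ℝ) : fejerWeight T y t *
        LSeries (fun n => (vonMangoldt.residueClass a n : ℂ)) (σ + t * Complex.I) =
        fejerWeight T y t * H σ t + (((q.totient : ℝ)⁻¹ : ℝ) : ℂ) *
          (fejerWeight T y t * (1 / (((σ - 1 : ℝ) : ℂ) + t * Complex.I))) := by
      have := vonMangoldt.eqOn_LFunctionResidueClassAux ha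
        (show (σ + t * Complex.I : ℂ) ∈ {s : ℂ | 1 < s.re} by simpa using hσ)
      simp only [hH, max_eq_left hσ.le]
      rw [this]
      push_cast
      ring
    simp only [hsplit] at hle
    have hcont1 : Continuous fun t => fejerWeight T y t * H σ t :=
      hwH.comp (Continuous.prodMk_right σ)
    have hcont3 : Continuous fun t : ℝ => (((q.totient : ℝ)⁻¹ : ℝ) : ℂ) *
        (fejerWeight T y t * (1 / (((σ - 1 : ℝ) : ℂ) + t * Complex.I))) :=
      continuous_const.mul hcont2
    rw [intervalIntegral.integral_add (hcont1.intervalIntegrable _ _)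
      (hcont3.intervalIntegrable _ _),
      intervalIntegral.integral_const_mul, Complex.add_re, Complex.re_ofReal_mul] at hle
    have := mul_le_mul_of_nonneg_left hpole (by positivity : 0 ≤ (q.totient : ℝ)⁻¹)
    linarith
  have hlim : Tendsto (fun σ : ℝ => (q.totient : ℝ)⁻¹ * (Real.exp (-(σ - 1) * (y + 1)) / 2) +
      (∫ t in (0 : ℝ)..T, fejerWeight T y t * H σ t).re) (𝓝[>] 1)
      (𝓝 ((q.totient : ℝ)⁻¹ * (Real.exp (-(1 - 1) * (y + 1)) / 2) +
      (∫ t in (0 : ℝ)..T, fejerWeight T y t * H 1 t).re)) := by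
    refine Continuous.continuousWithinAt ?_
    have := Complex.continuous_re.comp hΦ
    refine Continuous.add (by fun_prop) this
  have h := le_of_tendsto hlim (eventually_mem_nhdsWithin.mono hσ)
  simp only [sub_self, neg_zero, zero_mul, Real.exp_zero, hH, max_self, Complex.ofReal_one] at h
  refine le_trans (le_of_eq ?_) h
  ring

/-- For every `δ > 0` and all sufficiently large `y`, the interval `[e ^ (y - δ), e ^ (y + δ)]` contains a
prime in a given invertible residue class. -/
theorem eventually_exists_prime_residueClass_log_near {q : ℕ} [NeZero q] {a : ZMod q}
    (ha : IsUnit a) {δ : ℝ} (hδ : 0 < δ) :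
    ∀ᶠ y : ℝ in atTop, ∃ p : ℕ, p.Prime ∧ (p : ZMod q) = a ∧ |Real.log p - y| ≤ δ := by
  obtain ⟨C, hC0, hC⟩ := exists_sum_vonMangoldt_div_le
  set A : ℝ := (q.totient : ℝ)⁻¹ with hA
  have hA0 : 0 < A := by
    have := Nat.totient_pos.2 (Nat.pos_of_neZero q)
    positivity
  obtain ⟨T, hT1, hTC⟩ : ∃ T : ℝ, 1 ≤ T ∧ 4 * (1 + 1 / δ ^ 2) / T * C ≤ A / 8 := by
    refine ⟨max 1 (4 * (1 + 1 / δ ^ 2) * C * 8 / A), le_max_left _ _, ?_⟩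
    have h1 : 0 < max 1 (4 * (1 + 1 / δ ^ 2) * C * 8 / A) := lt_max_of_lt_left one_pos
    rw [div_mul_eq_mul_div, div_le_iff₀ h1]
    calc 4 * (1 + 1 / δ ^ 2) * C = A / 8 * (4 * (1 + 1 / δ ^ 2) * C * 8 / A) := by field_simp
      _ ≤ _ := by gcongr; exact le_max_right _ _
  have hT0 : 0 < T := by linarith
  have hR := (Complex.continuous_re.tendsto 0).comp (tendsto_integral_fejerWeight_mul T hT0.le
    fun t => vonMangoldt.LFunctionResidueClassAux a (1 + t * Complex.I))
  rw [Complex.zero_re] at hR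
  have hR' := hR.eventually_const_lt (show -(A / 8) < 0 by linarith)
  obtain ⟨s, hs⟩ := summable_iff_vanishing_norm.1
    (vonMangoldt.summable_residueClass_non_primes_div a) (A / (8 * T)) (by positivity)
  have hdisj := (Finset.eventually_all (l := atTop) s).2
    fun n _ => eventually_gt_atTop (Real.log n + δ)
  filter_upwards [eventually_ge_atTop 1, hR', hdisj] with y hy hRy hdy
  by_contra! hno
  have hkey := le_sum_residueClass_natsLogNear hC ha hT1 hδ hy
  simp only [Function.comp_apply] at hRy
  have hsum : ∑ n ∈ natsLogNear y δ, vonMangoldt.residueClass a n / n =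
      ∑ n ∈ natsLogNear y δ, (if n.Prime then 0 else vonMangoldt.residueClass a n) / n := by
    refine Finset.sum_congr rfl fun n hn => ?_
    split_ifs with hp
    · have : (n : ZMod q) ≠ a := fun h =>
        absurd ((mem_natsLogNear hp.ne_zero).1 hn) (not_le.2 (hno n hp h))
      simp [vonMangoldt.residueClass, this]
    · rfl
  have hd : Disjoint (natsLogNear y δ) s := by
    rw [Finset.disjoint_left]
    intro n hn hns
    have h1 := hdy n hns
    have h2 := (Finset.mem_filter.1 hn).2
    linarith [(abs_le.1 h2).1]
  have hlt := (le_abs_self _).trans_lt (hs _ hd)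
  rw [← hsum, lt_div_iff₀ (by positivity)] at hlt
  nlinarith

theorem exists_graph_iso_paleyGraph_sum_bot (n : ℕ) : ∃ G : SimpleGraph (Fin n), ∀ q : ℕ,
    IsGreatest {r : ℕ | r.Prime ∧ r % 4 = 1 ∧ r ≤ n} q →
      Nonempty (G ≃g (paleyGraph q ⊕g (⊥ : SimpleGraph (Fin (n - q))))) := by
  by_cases h : ∃ q, IsGreatest {r : ℕ | r.Prime ∧ r % 4 = 1 ∧ r ≤ n} q
  · obtain ⟨q, hq⟩ := h
    have : Fact q.Prime := ⟨hq.1.1⟩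
    have hcard : Fintype.card (ZMod q ⊕ Fin (n - q)) = n := by
      have := hq.1.2.2
      rw [Fintype.card_sum, ZMod.card, Fintype.card_fin]
      omega
    let e : Fin n ≃ ZMod q ⊕ Fin (n - q) := (Fintype.equivFinOfCardEq hcard).symm
    refine ⟨(paleyGraph q ⊕g (⊥ : SimpleGraph (Fin (n - q)))).comap e, fun q' hq' => ?_⟩
    obtain rfl := hq.unique hq'
    exact ⟨SimpleGraph.Iso.comap e _⟩
  · exact ⟨⊥, fun q hq => absurd ⟨q, hq⟩ h⟩

/-- The largest prime `q ≤ n` with `q ≡ 1 (mod 4)`, or `0` if there is none. -/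
def largestPrimeOneModFour (n : ℕ) : ℕ := Nat.findGreatest (fun r => r.Prime ∧ r % 4 = 1) n

theorem isGreatest_largestPrimeOneModFour {n : ℕ} (hn : 5 ≤ n) :
    IsGreatest {r : ℕ | r.Prime ∧ r % 4 = 1 ∧ r ≤ n} (largestPrimeOneModFour n) := by
  have h := Nat.findGreatest_spec (P := fun r => r.Prime ∧ r % 4 = 1) hn (by norm_num)
  exact ⟨⟨h.1, h.2, Nat.findGreatest_le n⟩,
    fun r hr => Nat.le_findGreatest hr.2.2 ⟨hr.1, hr.2.1⟩⟩

theorem tendsto_largestPrimeOneModFour_div :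
    Tendsto (fun n : ℕ => (largestPrimeOneModFour n : ℝ) / n) atTop (𝓝 1) := by
  refine tendsto_order.2 ⟨fun c hc => ?_, fun c hc => ?_⟩
  · obtain ⟨d, hd, hd1⟩ : ∃ d, max c (1 / 2) < d ∧ d < 1 :=
      exists_between (max_lt hc (by norm_num))
    have hd0 : 0 < d := lt_trans (by norm_num) ((le_max_right c (1 / 2)).trans_lt hd)
    have hδ : 0 < -Real.log d / 2 := by
      have := Real.log_neg hd0 hd1
      linarith
    have hlog : Tendsto (fun n : ℕ => Real.log n + Real.log d / 2) atTop atTop :=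
      tendsto_atTop_add_const_right _ _ (Real.tendsto_log_atTop.comp tendsto_natCast_atTop_atTop)
    filter_upwards [hlog.eventually (eventually_exists_prime_residueClass_log_near
      (q := 4) (a := 1) isUnit_one hδ), eventually_ge_atTop 1] with n ⟨p, hp, hp1, hpn⟩ hn
    have hn0 : (0 : ℝ) < n := by exact_mod_cast hn
    have hp0 : (0 : ℝ) < p := by exact_mod_cast hp.pos
    obtain ⟨h1, h2⟩ := abs_le.1 hpn
    have hple : p ≤ n := by
      have : Real.log p ≤ Real.log n := by linarith
      exact_mod_cast (Real.log_le_log_iff hp0 hn0).1 this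
    have hge : d * n ≤ p := by
      rw [← Real.log_le_log_iff (by positivity) hp0, Real.log_mul hd0.ne' hn0.ne']
      linarith
    have hmod : p % 4 = 1 := by
      have : (p : ZMod 4) = ((1 : ℕ) : ZMod 4) := by simpa using hp1
      exact (ZMod.natCast_eq_natCast_iff' p 1 4).1 this
    have hpq : (p : ℝ) ≤ largestPrimeOneModFour n := by
      have : p ≤ largestPrimeOneModFour n :=
        Nat.le_findGreatest (P := fun r => r.Prime ∧ r % 4 = 1) hple ⟨hp, hmod⟩
      exact_mod_cast this
    rw [lt_div_iff₀ hn0]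
    have : c < d := (le_max_left _ _).trans_lt hd
    nlinarith
  · refine Eventually.of_forall fun n => lt_of_le_of_lt (div_le_one_of_le₀ ?_ n.cast_nonneg) hc
    exact_mod_cast Nat.findGreatest_le n

theorem tendsto_paley_lower_bound {p : ℝ} {q : ℕ → ℕ}
    (hq : Tendsto (fun n : ℕ => (q n : ℝ) / n) atTop (𝓝 1)) :
    Tendsto (fun n : ℕ => (((q n : ℝ) - 1) * ((√(q n) - 1) / 2) ^ p) / (n : ℝ) ^ (1 + p / 2))
      atTop (𝓝 ((2 : ℝ) ^ (-p))) := by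
  have hinv : Tendsto (fun n : ℕ => ((n : ℝ))⁻¹) atTop (𝓝 0) :=
    tendsto_inv_atTop_zero.comp tendsto_natCast_atTop_atTop
  have h1 : Tendsto (fun n : ℕ => (q n : ℝ) / n - (n : ℝ)⁻¹) atTop (𝓝 1) := by
    simpa using hq.sub hinv
  have h2 : Tendsto (fun n : ℕ => (√((q n : ℝ) / n) - √((n : ℝ)⁻¹)) / 2) atTop (𝓝 (2⁻¹)) := by
    have := ((hq.sqrt).sub hinv.sqrt).div_const 2
    simpa using this
  have h3 := h1.mul (h2.rpow_const (p := p) (Or.inl (by norm_num)))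
  rw [one_mul, Real.inv_rpow zero_le_two, ← Real.rpow_neg zero_le_two] at h3
  refine h3.congr' ?_
  have hpos := hq.eventually_const_lt (show (1 / 2 : ℝ) < 1 by norm_num)
  filter_upwards [eventually_ge_atTop 2, hpos] with n hn hqn
  have hn2 : (2 : ℝ) ≤ n := by exact_mod_cast hn
  have hn0 : (0 : ℝ) < n := by linarith
  have hq1 : (1 : ℝ) ≤ q n := by
    rw [lt_div_iff₀ hn0] at hqn
    linarith
  have hs : 1 ≤ √(q n : ℝ) := Real.one_le_sqrt.2 hq1
  have e1 : (√((q n : ℝ) / n) - √((n : ℝ)⁻¹)) / 2 = (√(q n) - 1) / 2 / √n := by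
    rw [Real.sqrt_div (by positivity), Real.sqrt_inv]
    ring
  have e2 : √(n : ℝ) ^ p = (n : ℝ) ^ (p / 2) := by
    rw [Real.sqrt_eq_rpow, ← Real.rpow_mul hn0.le]
    ring_nf
  rw [e1, Real.div_rpow (by linarith) (by positivity), e2, Real.rpow_add hn0, Real.rpow_one]
  ring

theorem mainTheorem8 :
    (∀ (p : ℝ), 1 ≤ p → p < 2 →
      ∀ (n : ℕ) (V : Type*) [Fintype V] (G : SimpleGraph V), Fintype.card V = n →
        G.schattenNorm p ^ p ≤ (2 : ℝ) ^ (-p) * (n : ℝ) ^ (1 + p / 2) + (n : ℝ) ^ p) ∧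
    (∃ G : (n : ℕ) → SimpleGraph (Fin n),
      (∀ n q : ℕ, IsGreatest {r : ℕ | r.Prime ∧ r % 4 = 1 ∧ r ≤ n} q →
        Nonempty (G n ≃g (paleyGraph q ⊕g (⊥ : SimpleGraph (Fin (n - q)))))) ∧
      ∀ (p : ℝ), 1 ≤ p → p < 2 →
        ∃ ε : ℕ → ℝ, Tendsto ε atTop (𝓝 0) ∧
          ∀ n : ℕ, (G n).schattenNorm p ^ p =
            ((2 : ℝ) ^ (-p) + ε n) * (n : ℝ) ^ (1 + p / 2)) := by
  refine ⟨fun p hp hp2 n V _ G hn => hn ▸ G.schattenNorm_rpow_le hp hp2, ?_⟩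
  choose G hG using exists_graph_iso_paleyGraph_sum_bot
  refine ⟨G, hG, fun p hp hp2 => ?_⟩
  have hup (n : ℕ) : (G n).schattenNorm p ^ p ≤
      (2 : ℝ) ^ (-p) * (n : ℝ) ^ (1 + p / 2) + (n : ℝ) ^ p := by
    simpa using (G n).schattenNorm_rpow_le hp hp2
  have hlo (n : ℕ) (hn : 5 ≤ n) : ((largestPrimeOneModFour n : ℝ) - 1) *
      ((√(largestPrimeOneModFour n) - 1) / 2) ^ p ≤ (G n).schattenNorm p ^ p := by
    have hq := isGreatest_largestPrimeOneModFour hn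
    have : Fact (largestPrimeOneModFour n).Prime := ⟨hq.1.1⟩
    obtain ⟨e⟩ := hG n _ hq
    rw [e.schattenNorm_rpow_eq hp, SimpleGraph.schattenNorm_rpow_sum_bot _ hp]
    exact paleyGraph_schattenNorm_ge hq.1.2.1 hp
  refine ⟨fun n => (G n).schattenNorm p ^ p / (n : ℝ) ^ (1 + p / 2) - 2 ^ (-p), ?_, fun n => ?_⟩
  · rw [← sub_self ((2 : ℝ) ^ (-p))]
    refine Tendsto.sub_const ?_ _
    have hU : Tendsto (fun n : ℕ => (2 : ℝ) ^ (-p) + (n : ℝ) ^ (-(1 - p / 2))) atTop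
        (𝓝 ((2 : ℝ) ^ (-p))) := by
      simpa using ((tendsto_rpow_neg_atTop (by linarith : 0 < 1 - p / 2)).comp
        tendsto_natCast_atTop_atTop).const_add ((2 : ℝ) ^ (-p))
    refine tendsto_of_tendsto_of_tendsto_of_le_of_le'
      (tendsto_paley_lower_bound tendsto_largestPrimeOneModFour_div) hU ?_ ?_
    · filter_upwards [eventually_ge_atTop 5] with n hn
      exact div_le_div_of_nonneg_right (hlo n hn) (by positivity)
    · filter_upwards [eventually_ge_atTop 1] with n hn
      have hn0 : (0 : ℝ) < n := by exact_mod_cast hn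
      rw [div_le_iff₀ (by positivity), add_mul, ← Real.rpow_add hn0,
        show -(1 - p / 2) + (1 + p / 2) = p by ring]
      exact hup n
  · rw [add_sub_cancel]
    rcases Nat.eq_zero_or_pos n with rfl | hn
    · have h1 := hup 0
      have h2 : 0 ≤ (G 0).schattenNorm p ^ p := by
        classical
        rw [(G 0).schattenNorm_rpow hp]
        exact Finset.sum_nonneg fun i _ =>
          Real.rpow_nonneg (LinearMap.singularValues_nonneg _ i) _
      have hp0 : p ≠ 0 := by linarith
      have hp1 : 1 + p / 2 ≠ 0 := by linarith
      simp only [Nat.cast_zero, Real.zero_rpow hp0, Real.zero_rpow hp1, mul_zero, add_zero] at h1 ⊢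
      exact le_antisymm h1 h2
    · have hn0 : (0 : ℝ) < n := by exact_mod_cast hn
      rw [div_mul_cancel₀ _ (by positivity)]
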